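/- A digraph $\Gamma$ on the vertex set $\{1,\dots,n\}$ may have multiple edges and loops; $\deg(i,j)\in\mathbb Z_{\ge 0}$ denotes the number of edges from $i$ to $j$, and $\operatorname{outdeg}(i)=\sum_{j}\deg(i,j)$. Its Laplacian is the integer $n\times n$ matrix $L$ with $L_{ij}=-\deg(i,j)$ for $i\neq j$ and $L_{ii}=\operatorname{outdeg}(i)-\deg(i,i)$. The rows of $L$ lie in the group $\mathbb Z^n_0$ of integer vectors whose entries sum to zero, and the total sandpile group of $\Gamma$ is $S(\Gamma)=\mathbb Z^n_0/\mathbb Z^nL$, where $\mathbb Z^nL=\{vL : v\in\mathbb Z^n\}$ ($v$ a row vector) is the subgroup generated by the rows of $L$. For $\epsilon>0$, a random digraph $\Gamma$ is called $\epsilon$-balanced if the random variables $\deg(i,j)$, over all ordered pairs of distinct vertices $i\ne j$, are independent and satisfy $\mathbb P(\deg(i,j)\equiv r \pmod p)\le 1-\epsilon$ for every prime $p$ and every $r\in\mathbb Z/p\mathbb Z$. The variables need not be identically distributed, and no condition is placed on the numbers of loops $\deg(i,i)$. **Theorem 3.1.** Let $a$ be a positive integer, let $\epsilon>0$, and let $G$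 be a finite abelian group whose exponent divides $a$. Then there exist constants $K,c>0$, depending only on $a$, $\epsilon$ and $G$, such that for every $n\ge 0$ and every $\epsilon$-balanced random digraph $\Gamma$ on $n$ vertices, with $S=S(\Gamma)$, the number $\#\operatorname{Sur}(S,G)$ of surjective group homomorphisms $S\to G$ has finite expectation and $$\left|\mathbb E\bigl(\#\operatorname{Sur}(S,G)\bigr)-\frac1{|G|}\right|\le K e^{-cn}.$$ -/

import Mathlib

open MeasureTheory ProbabilityTheory

/-- A directed graph on the vertex set `V` with multiple edges and loops permitted, recorded by
the number `deg i j` of edges from `i` to `j`. -/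
structure MultiDigraph (V : Type*) where
  deg : V → V → ℕ

namespace MultiDigraph

variable {V : Type*} [Fintype V]

/-- The number of edges leaving the vertex `i` (loops included). -/
def outdeg (Γ : MultiDigraph V) (i : V) : ℕ := ∑ j, Γ.deg i j

/-- The laplacian: `L i j = -deg i j` for `i ≠ j` and `L i i = outdeg i - deg i i`.
All its rows sum to zero. -/
def laplacian [DecidableEq V] (Γ : MultiDigraph V) : Matrix V V ℤ :=
  Matrix.of fun i j => if i = j then (Γ.outdeg i : ℤ) - Γ.deg i i else -(Γ.deg i j : ℤ)

/-- The integer vectors whose entries sum to zero. -/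
def sumZero (V : Type*) [Fintype V] : Submodule ℤ (V → ℤ) where
  carrier := {x | ∑ i, x i = 0}
  add_mem' {x y} hx hy := by
    simp only [Set.mem_ofPred_eq] at hx hy ⊢
    simp [Finset.sum_add_distrib, hx, hy]
  zero_mem' := by simp
  smul_mem' k x hx := by
    simp only [Set.mem_ofPred_eq] at hx ⊢
    simp [← Finset.mul_sum, hx]

/-- The image of `ℤ^V` under the laplacian, whose row `i` is the effect (up to sign) of firing
the vertex `i`: the set of integer combinations `v ᵥ* L` of the rows of `L`. -/
def laplacianImage [DecidableEq V] (Γ : MultiDigraph V) : Submodule ℤ (V → ℤ) :=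
  LinearMap.range Γ.laplacian.vecMulLinear

/-- The image of the laplacian consists of vectors with entries summing to zero. -/
theorem laplacianImage_le_sumZero [DecidableEq V] (Γ : MultiDigraph V) :
    Γ.laplacianImage ≤ sumZero V := by
  rintro _ ⟨v, rfl⟩
  change ∑ j, ∑ i, v i * Γ.laplacian i j = 0
  rw [Finset.sum_comm]
  refine Finset.sum_eq_zero fun i _ => ?_
  rw [← Finset.mul_sum, ← Finset.add_sum_erase _ _ (Finset.mem_univ i)]
  have h : ∑ j ∈ Finset.univ.erase i, Γ.laplacian i j
      = -∑ j ∈ Finset.univ.erase i, (Γ.deg i j : ℤ) := by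
    rw [← Finset.sum_neg_distrib]
    refine Finset.sum_congr rfl fun j hj => ?_
    simp [laplacian, (Finset.ne_of_mem_erase hj).symm]
  have h2 : (Γ.outdeg i : ℤ) = Γ.deg i i + ∑ j ∈ Finset.univ.erase i, (Γ.deg i j : ℤ) := by
    rw [outdeg, Nat.cast_sum, ← Finset.add_sum_erase _ _ (Finset.mem_univ i)]
  rw [h]
  simp [laplacian, h2]

/-- The total sandpile group: the quotient of the group of integer vectors with entry sum zero
by the image of the laplacian (which lies in it). -/
abbrev TotalSandpile [DecidableEq V] (Γ : MultiDigraph V) : Type _ :=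
  sumZero V ⧸ Γ.laplacianImage.submoduleOf (sumZero V)

end MultiDigraph

/-- The random variable `y` in the commutative ring `T` is `ε`-balanced: modulo every maximal
ideal, every residue class has probability at most `1 - ε`. -/
def IsBalanced {Ω : Type*} [MeasurableSpace Ω] {T : Type*} [CommRing T]
    (ε : ℝ) (y : Ω → T) (μ : Measure Ω) : Prop :=
  ∀ 𝔭 : Ideal T, 𝔭.IsMaximal → ∀ r : T ⧸ 𝔭,
    μ.real {ω | Ideal.Quotient.mk 𝔭 (y ω) = r} ≤ 1 - ε

/-- An `ε`-balanced random digraph: all edge multiplicities are random variables, and those at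
the pairs of distinct vertices are independent and `ε`-balanced over `ℤ`. -/
structure IsBalancedDigraph {Ω : Type*} [MeasurableSpace Ω] {V : Type*}
    (ε : ℝ) (Γ : Ω → MultiDigraph V) (μ : Measure Ω) : Prop where
  measurable : ∀ i j : V, Measurable fun ω => (Γ ω).deg i j
  indep : iIndepFun (fun (e : {e : V × V // e.1 ≠ e.2}) (ω : Ω) =>
    (Γ ω).deg e.1.1 e.1.2) μ
  balanced : ∀ i j : V, i ≠ j → IsBalanced ε (fun ω => ((Γ ω).deg i j : ℤ)) μ

/-- The number of surjective homomorphisms `S → G`. (For finitely generated `S` and finite `G`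
there are finitely many homomorphisms.) -/
noncomputable def numSur (S G : Type*) [AddCommGroup S] [AddCommGroup G] : ℕ :=
  Nat.card {f : S →+ G // Function.Surjective f}

/-!
If `V` is nonempty, a homomorphism from the sandpile group of `Γ` to `G` together with an element of
`G` is the same as a harmonic vector `f : V → G`, one with `∑ j, deg i j • (f i - f j) = 0` for every vertex `i`;
it is surjective exactly when `f` is spread, that is, when the differences of the entries of `f`
generate `G`. So `|G| * #Sur(S, G)` counts the harmonic spread vectors. Detect the harmonic equation
at each vertex by summing over the characters of `G` and take expectations: independence gives
`|G| ^ n * ℙ(f is harmonic) = ∏ i, ∑ ψ, ∏ j, 𝔼 ψ(deg i j • (f i - f j))`. The trivial character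
contributes `1` at each vertex, and balancedness bounds each expectation with `ψ (f i) ≠ ψ (f j)`
by some `ρ < 1` depending only on `ε` and `G`.

If no nontrivial `ψ` is almost constant along `f`, the product is exponentially close to `1`.
Otherwise let `A` be the set of almost constant characters. Each factor is at most `#A * (1 - κ)`
because every `ψ ∈ A` other than the trivial one still takes two values along a spread `f`, while
almost all entries of `f` lie in a common fibre of `A`, which has at most `|G| / #A` elements. Hence
such vectors contribute an exponentially small share of the average over all `|G| ^ n` vectors.
-/

open scoped Topology Matrix

section Balanced

/-- A variant of `IsBalanced` that tests only the prime divisors of `m`: modulo each of them, every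
residue class has probability at most `1 - ε`. -/
def IsBalancedMod {Ω : Type*} [MeasurableSpace Ω] (m : ℕ) (ε : ℝ) (y : Ω → ℕ) (μ : Measure Ω) :
    Prop :=
  ∀ p : ℕ, p.Prime → p ∣ m → ∀ r : ZMod p, μ.real {ω | (y ω : ZMod p) = r} ≤ 1 - ε

/-- A variant of `IsBalancedDigraph` that tests only the prime divisors of `m` and puts no condition
on the loops. -/
structure IsBalancedDigraphMod {Ω : Type*} [MeasurableSpace Ω] {V : Type*}
    (m : ℕ) (ε : ℝ) (Γ : Ω → MultiDigraph V) (μ : Measure Ω) : Prop where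
  measurable : ∀ i j : V, i ≠ j → Measurable fun ω => (Γ ω).deg i j
  indep : iIndepFun (fun (e : {e : V × V // e.1 ≠ e.2}) (ω : Ω) => (Γ ω).deg e.1.1 e.1.2) μ
  balanced : ∀ i j : V, i ≠ j → IsBalancedMod m ε (fun ω => (Γ ω).deg i j) μ

variable {Ω : Type*} [MeasurableSpace Ω] {μ : Measure Ω} {ε : ℝ}

theorem IsBalanced.isBalancedMod {y : Ω → ℕ} (hy : IsBalanced ε (fun ω => (y ω : ℤ)) μ) (m : ℕ) :
    IsBalancedMod m ε y μ := by
  intro p hp _ r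
  have hmax : (Ideal.span {(p : ℤ)}).IsMaximal :=
    PrincipalIdealRing.isMaximal_of_irreducible (Nat.prime_iff_prime_int.mp hp).irreducible
  convert! hy _ hmax ((Int.quotientSpanNatEquivZMod p).symm r) using 4 with ω
  rw [RingEquiv.eq_symm_apply]
  simp

theorem IsBalancedDigraph.isBalancedDigraphMod {V : Type*} {Γ : Ω → MultiDigraph V}
    (hΓ : IsBalancedDigraph ε Γ μ) (m : ℕ) : IsBalancedDigraphMod m ε Γ μ where
  measurable i j _ := hΓ.measurable i j
  indep := hΓ.indep
  balanced i j hij := (hΓ.balanced i j hij).isBalancedMod m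

end Balanced

section Contraction

theorem exists_pos_forall_inner_le_one_sub {E : Type*} [NormedAddCommGroup E]
    [InnerProductSpace ℝ E] {s : Set E} (hs : s.Finite) (hs1 : ∀ z ∈ s, ‖z‖ = 1) :
    ∃ δ : ℝ, 0 < δ ∧ ∀ u ∈ s, ∀ v ∈ s, u ≠ v → inner ℝ u v ≤ 1 - δ := by
  have hev : ∀ᶠ δ : ℝ in 𝓝[>] 0, ∀ q ∈ s ×ˢ s, q.1 ≠ q.2 → δ < 1 - inner ℝ q.1 q.2 := by
    refine (Filter.eventually_all_finite (hs.prod hs)).2 fun q hq => ?_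
    rw [Filter.eventually_imp_distrib_left]
    intro hne
    have hlt := (inner_lt_one_iff_real_of_norm_eq_one (hs1 _ hq.1) (hs1 _ hq.2)).2 hne
    exact eventually_nhdsWithin_of_eventually_nhds (eventually_lt_nhds (sub_pos.2 hlt))
  obtain ⟨δ, hδ, hδ0⟩ := (hev.and self_mem_nhdsWithin).exists
  exact ⟨δ, hδ0, fun u hu v hv huv => by linarith [hδ (u, v) ⟨hu, hv⟩ huv]⟩

theorem exists_norm_integral_le_of_finite {E : Type*} [NormedAddCommGroup E]
    [InnerProductSpace ℝ E] [CompleteSpace E] {s : Set E} (hs : s.Finite)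
    (hs1 : ∀ z ∈ s, ‖z‖ = 1) {ε : ℝ} (hε : 0 < ε) :
    ∃ ρ : ℝ, 0 < ρ ∧ ρ < 1 ∧
      ∀ (Ω : Type*) [MeasurableSpace Ω] (μ : Measure Ω) [IsProbabilityMeasure μ] (Z : Ω → E),
        StronglyMeasurable Z → (∀ ω, Z ω ∈ s) →
        (∀ ω', μ.real {ω | Z ω = Z ω'} ≤ 1 - ε) → ‖∫ ω, Z ω ∂μ‖ ≤ ρ := by
  obtain ⟨δ, hδ, hsep⟩ := exists_pos_forall_inner_le_one_sub hs hs1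
  refine ⟨max (1 / 2) (1 - δ * ε / 2), by positivity,
    max_lt (by norm_num) (by nlinarith [mul_pos hδ hε]), ?_⟩
  intro Ω _ μ _ Z hZ hZs hbal
  refine le_max_of_le_right ?_
  set I := ∫ ω, Z ω ∂μ with hI
  have hint : Integrable Z μ :=
    .of_bound hZ.aestronglyMeasurable 1 (.of_forall fun ω => (hs1 _ (hZs ω)).le)
  have hinner : ∀ ω', inner ℝ (Z ω') I ≤ 1 - δ * ε := by
    intro ω'
    set A := {ω | Z ω = Z ω'}
    have hA : MeasurableSet A := hZ.measurableSet_eq_fun stronglyMeasurable_const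
    have hindA : Integrable (A.indicator fun _ => δ) μ := (integrable_const δ).indicator hA
    have hpt : ∀ ω, inner ℝ (Z ω') (Z ω) ≤ (1 - δ) + A.indicator (fun _ => δ) ω := by
      intro ω
      by_cases hω : ω ∈ A
      · have hω' : Z ω = Z ω' := hω
        simp [hω, hω', hs1 _ (hZs ω')]
      · simpa [hω] using hsep _ (hZs ω') _ (hZs ω) (Ne.symm hω)
    calc inner ℝ (Z ω') I = ∫ ω, inner ℝ (Z ω') (Z ω) ∂μ := (integral_inner hint _).symm
      _ ≤ ∫ ω, ((1 - δ) + A.indicator (fun _ => δ) ω) ∂μ :=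
        integral_mono (hint.const_inner _) ((integrable_const _).add hindA) hpt
      _ = 1 - δ + μ.real A * δ := by
        rw [integral_add (integrable_const _) hindA, integral_indicator_const _ hA]
        simp
      _ ≤ 1 - δ * ε := by nlinarith [hbal ω']
  have hsq : ‖I‖ ^ 2 ≤ 1 - δ * ε :=
    calc ‖I‖ ^ 2 = inner ℝ I I := (real_inner_self_eq_norm_sq I).symm
      _ = ∫ ω, inner ℝ (Z ω) I ∂μ := by
        rw [hI, ← integral_inner hint]
        simp only [real_inner_comm]
      _ ≤ ∫ _, (1 - δ * ε) ∂μ := integral_mono (hint.inner_const _) (integrable_const _) hinner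
      _ = 1 - δ * ε := by simp
  have h0 : 0 ≤ 1 - δ * ε := (sq_nonneg _).trans hsq
  exact le_of_sq_le_sq (by nlinarith [sq_nonneg (δ * ε)]) (by linarith)

theorem exists_prime_dvd_exponent_forall_natCast_eq {G : Type*} [AddCommGroup G]
    {ψ : AddChar G ℂ} {g : G} (hg : ψ g ≠ 1) :
    ∃ p : ℕ, p.Prime ∧ p ∣ AddMonoid.exponent G ∧
      ∀ k l : ℕ, ψ (k • g) = ψ (l • g) → (k : ZMod p) = l := by
  obtain ⟨u, hu⟩ := ψ.val_isUnit g
  have hpow : ∀ k : ℕ, ψ (k • g) = (u ^ k : ℂˣ) := fun k => by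
    rw [ψ.map_nsmul_eq_pow, Units.val_pow_eq_pow_val, hu]
  have hu1 : orderOf u ≠ 1 := fun h => hg (by simpa [orderOf_eq_one_iff.1 h] using hu.symm)
  have hdvd : orderOf u ∣ AddMonoid.exponent G := orderOf_dvd_of_pow_eq_one <| Units.ext <| by
    simpa [AddMonoid.exponent_nsmul_eq_zero] using (hpow (AddMonoid.exponent G)).symm
  refine ⟨(orderOf u).minFac, Nat.minFac_prime hu1, (Nat.minFac_dvd _).trans hdvd,
    fun k l hkl => ?_⟩
  rw [hpow, hpow, Units.val_inj, pow_eq_pow_iff_modEq] at hkl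
  exact (ZMod.natCast_eq_natCast_iff _ _ _).2 (hkl.of_dvd (Nat.minFac_dvd _))

theorem exists_norm_integral_addChar_nsmul_le (G : Type*) [AddCommGroup G] [Finite G] {ε : ℝ}
    (hε : 0 < ε) :
    ∃ ρ : ℝ, 0 < ρ ∧ ρ < 1 ∧
      ∀ (Ω : Type*) [MeasurableSpace Ω] (μ : Measure Ω) [IsProbabilityMeasure μ] (y : Ω → ℕ),
        Measurable y → IsBalancedMod (AddMonoid.exponent G) ε y μ →
        ∀ (ψ : AddChar G ℂ) (g : G), ψ g ≠ 1 → ‖∫ ω, ψ (y ω • g) ∂μ‖ ≤ ρ := by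
  obtain ⟨ρ, hρ, hρ1, hmain⟩ := exists_norm_integral_le_of_finite
    (Set.finite_range fun q : AddChar G ℂ × G => q.1 q.2)
    (by rintro _ ⟨q, rfl⟩; exact q.1.norm_apply q.2) hε
  refine ⟨ρ, hρ, hρ1, fun Ω _ μ _ y hy hbal ψ g hg => ?_⟩
  obtain ⟨p, hp, hpG, hmod⟩ := exists_prime_dvd_exponent_forall_natCast_eq hg
  have hmeas : Measurable fun ω => ψ (y ω • g) :=
    (measurable_from_nat (f := fun k : ℕ => ψ (k • g))).comp hy
  exact hmain Ω μ _ hmeas.stronglyMeasurable (fun ω => ⟨(ψ, y ω • g), rfl⟩) fun ω' =>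
    (measureReal_mono fun ω hω => hmod _ _ hω).trans (hbal p hp hpG (y ω'))

end Contraction

section Characters

open Finset

theorem addChar_map_sum_eq_prod {A M ι : Type*} [AddCommMonoid A] [CommMonoid M] (ψ : AddChar A M)
    (s : Finset ι) (g : ι → A) : ψ (∑ i ∈ s, g i) = ∏ i ∈ s, ψ (g i) :=
  map_prod ψ.toMonoidHom (fun i => Multiplicative.ofAdd (g i)) s

variable {G : Type*} [AddCommGroup G] [Fintype G]

theorem sum_prod_addChar_eq_ite [DecidableEq G] {ι : Type*} (s : Finset ι) (h : ι → G) :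
    ∑ ψ : AddChar G ℂ, ∏ j ∈ s, ψ (h j) = if ∑ j ∈ s, h j = 0 then (Fintype.card G : ℂ) else 0 := by
  simp_rw [← addChar_map_sum_eq_prod]
  exact AddChar.sum_apply_eq_ite _

theorem sum_norm_sq_sum_addChar (F : Finset G) :
    ∑ ψ : AddChar G ℂ, ‖∑ x ∈ F, ψ x‖ ^ 2 = Fintype.card G * #F := by
  classical
  suffices h : ∑ ψ : AddChar G ℂ, (∑ x ∈ F, ψ x) * starRingEnd ℂ (∑ x ∈ F, ψ x)
      = Fintype.card G * #F by
    simp_rw [Complex.mul_conj'] at h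
    exact_mod_cast h
  calc ∑ ψ : AddChar G ℂ, (∑ x ∈ F, ψ x) * starRingEnd ℂ (∑ x ∈ F, ψ x)
      = ∑ ψ : AddChar G ℂ, ∑ x ∈ F, ∑ y ∈ F, ψ (x - y) := by
        simp_rw [map_sum, sum_mul_sum, sub_eq_add_neg, AddChar.map_add_eq_mul,
          AddChar.map_neg_eq_conj]
    _ = ∑ x ∈ F, ∑ y ∈ F, ∑ ψ : AddChar G ℂ, ψ (x - y) := by
        rw [sum_comm]
        exact sum_congr rfl fun x _ => sum_comm
    _ = ∑ x ∈ F, ∑ y ∈ F, if x = y then (Fintype.card G : ℂ) else 0 := by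
        simp_rw [AddChar.sum_apply_eq_ite, sub_eq_zero]
    _ = Fintype.card G * #F := by
        simp +contextual [mul_comm]

open Classical in
/-- The set of points at which all characters in `A` take the same values as at `g`. -/
noncomputable def commonFibre (A : Finset (AddChar G ℂ)) (g : G) : Finset G :=
  {x | ∀ ψ ∈ A, ψ x = ψ g}

theorem mem_commonFibre {A : Finset (AddChar G ℂ)} {g x : G} :
    x ∈ commonFibre A g ↔ ∀ ψ ∈ A, ψ x = ψ g := by
  simp [commonFibre]

theorem card_mul_card_commonFibre_le (A : Finset (AddChar G ℂ)) (g : G) :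
    #A * #(commonFibre A g) ≤ Fintype.card G := by
  have hconst : ∀ ψ ∈ A, ‖∑ x ∈ commonFibre A g, ψ x‖ = #(commonFibre A g) := fun ψ hψ => by
    rw [sum_congr rfl fun x hx => mem_commonFibre.1 hx ψ hψ]
    simp [ψ.norm_apply]
  have hle : (#A : ℝ) * #(commonFibre A g) ^ 2 ≤ Fintype.card G * #(commonFibre A g) :=
    calc (#A : ℝ) * #(commonFibre A g) ^ 2 = ∑ ψ ∈ A, ‖∑ x ∈ commonFibre A g, ψ x‖ ^ 2 := by
          rw [sum_congr rfl fun ψ hψ => by rw [hconst ψ hψ], sum_const, nsmul_eq_mul]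
      _ ≤ ∑ ψ : AddChar G ℂ, ‖∑ x ∈ commonFibre A g, ψ x‖ ^ 2 :=
          sum_le_univ_sum_of_nonneg fun ψ => sq_nonneg _
      _ = Fintype.card G * #(commonFibre A g) := sum_norm_sq_sum_addChar _
  have hpos : 0 < #(commonFibre A g) := card_pos.2 ⟨g, mem_commonFibre.2 fun _ _ => rfl⟩
  refine Nat.le_of_mul_le_mul_right ?_ hpos
  rw [mul_assoc, ← sq]
  exact_mod_cast hle

end Characters

section Spread

/-- A vector over `G` is spread if no nontrivial character is constant along it, that is, if the
differences of its entries generate `G`. -/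
def IsSpread {V G : Type*} [AddCommGroup G] (f : V → G) : Prop :=
  ∀ ψ : AddChar G ℂ, ψ ≠ 0 → ∃ j k, ψ (f j) ≠ ψ (f k)

theorem surjective_iff_forall_addChar {H G : Type*} [AddCommGroup H] [AddCommGroup G] [Finite G]
    (φ : H →+ G) :
    Function.Surjective φ ↔ ∀ ψ : AddChar G ℂ, ψ ≠ 0 → ∃ x, ψ (φ x) ≠ 1 := by
  constructor
  · intro hφ ψ hψ
    obtain ⟨g, hg⟩ := AddChar.ne_zero_iff.1 hψ
    obtain ⟨x, rfl⟩ := hφ g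
    exact ⟨x, hg⟩
  · intro h g
    by_contra hg
    obtain ⟨χ, hχ⟩ := AddChar.exists_apply_ne_zero.2
      (mt (QuotientAddGroup.eq_zero_iff (N := φ.range) g).1 hg)
    obtain ⟨x, hx⟩ := h (χ.compAddMonoidHom (QuotientAddGroup.mk' φ.range))
      (AddChar.ne_zero_iff.2 ⟨g, hχ⟩)
    have hx0 : QuotientAddGroup.mk' φ.range (φ x) = 0 := (QuotientAddGroup.eq_zero_iff _).2 ⟨x, rfl⟩
    exact hx (by rw [AddChar.compAddMonoidHom_apply, hx0, AddChar.map_zero_eq_one])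

end Spread

namespace MultiDigraph

variable {V : Type*} [Fintype V] {G : Type*} [AddCommGroup G]

/-- The linear map sending an integer vector `x` with entry sum zero to `∑ j, x j • f j`. -/
def pairing (f : V → G) : sumZero V →ₗ[ℤ] G :=
  (Fintype.linearCombination ℤ f).domRestrict (sumZero V)

/-- A vector `f` is harmonic if it is annihilated by the rows of the laplacian. -/
def IsHarmonic (Γ : MultiDigraph V) (f : V → G) : Prop :=
  ∀ i, ∑ j, Γ.deg i j • (f i - f j) = 0

/-- The difference `e i - e j` of two standard basis vectors. -/
def singleSub [DecidableEq V] (i j : V) : sumZero V :=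
  ⟨Pi.single i 1 - Pi.single j 1,
    show ∑ k, (Pi.single i 1 - Pi.single j 1 : V → ℤ) k = 0 by simp [Finset.sum_sub_distrib]⟩

theorem singleSub_self [DecidableEq V] (j : V) : singleSub j j = 0 :=
  Subtype.ext (sub_self _)

theorem eq_sum_smul_singleSub [DecidableEq V] (x : sumZero V) (j₀ : V) :
    x = ∑ j, (x : V → ℤ) j • singleSub j j₀ := by
  have hx : ∑ j, (x : V → ℤ) j = 0 := x.2
  ext k
  simp [singleSub, mul_sub, Finset.sum_sub_distrib, hx, Pi.single_apply]

theorem pairing_singleSub [DecidableEq V] (f : V → G) (i j : V) :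
    pairing f (singleSub i j) = f i - f j := by
  simp [pairing, singleSub]

theorem pairing_map_singleSub_add [DecidableEq V] (φ : sumZero V →ₗ[ℤ] G) (j₀ : V) (g : G) :
    pairing (fun j => φ (singleSub j j₀) + g) = φ := by
  ext x
  rw [eq_sum_smul_singleSub x j₀, map_sum, map_sum]
  simp [pairing_singleSub, singleSub_self]

theorem pairing_surjective_iff [Finite G] {f : V → G} :
    Function.Surjective (pairing f) ↔ IsSpread f := by
  classical
  refine (surjective_iff_forall_addChar (pairing f).toAddMonoidHom).trans
    (forall₂_congr fun ψ _ => ⟨?_, ?_⟩)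
  · rintro ⟨x, hx⟩
    contrapose! hx
    rcases isEmpty_or_nonempty V with _ | ⟨⟨j₀⟩⟩
    · simp [Subsingleton.elim x 0]
    have hdiff : ∀ j, ψ (pairing f (singleSub j j₀)) = 1 := fun j => by
      rw [pairing_singleSub, ψ.map_sub_eq_div, hx j j₀, div_self (ψ.val_isUnit _).ne_zero]
    rw [eq_sum_smul_singleSub x j₀, LinearMap.toAddMonoidHom_coe, map_sum, addChar_map_sum_eq_prod]
    exact Finset.prod_eq_one fun j _ => by rw [map_zsmul, ψ.map_zsmul_eq_zpow, hdiff, one_zpow]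
  · rintro ⟨j, k, hjk⟩
    refine ⟨singleSub j k, fun h => hjk ?_⟩
    rw [LinearMap.toAddMonoidHom_coe, pairing_singleSub, ψ.map_sub_eq_div] at h
    exact eq_of_div_eq_one h

variable [DecidableEq V]

theorem sum_laplacian_smul (Γ : MultiDigraph V) (f : V → G) (i : V) :
    ∑ j, Γ.laplacian i j • f j = ∑ j, Γ.deg i j • (f i - f j) := by
  have hentry : ∀ j, Γ.laplacian i j = (if i = j then (Γ.outdeg i : ℤ) else 0) - Γ.deg i j := by
    intro j
    by_cases hij : i = j
    · subst hij; simp [laplacian]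
    · simp [laplacian, hij]
  have houtdeg : Γ.outdeg i • f i = ∑ j, Γ.deg i j • f i := by
    rw [outdeg, Finset.sum_smul]
  simp [hentry, sub_smul, smul_sub, Finset.sum_sub_distrib, houtdeg]

theorem isHarmonic_iff_le_ker_pairing (Γ : MultiDigraph V) (f : V → G) :
    Γ.IsHarmonic f ↔
      Γ.laplacianImage.submoduleOf (sumZero V) ≤ LinearMap.ker (pairing f) := by
  have hrow : ∀ i, Fintype.linearCombination ℤ f (Pi.single i 1 ᵥ* Γ.laplacian)
      = ∑ j, Γ.deg i j • (f i - f j) := fun i => by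
    simp [Fintype.linearCombination_apply, ← sum_laplacian_smul]
  constructor
  · rintro hf x ⟨v, hv⟩
    have hzero : Fintype.linearCombination ℤ f ∘ₗ Γ.laplacian.vecMulLinear = 0 :=
      LinearMap.pi_ext' fun i => LinearMap.ext_ring ((hrow i).trans (hf i))
    have hx : (x : V → ℤ) = Γ.laplacian.vecMulLinear v := hv.symm
    rw [LinearMap.mem_ker, pairing, LinearMap.domRestrict_apply, hx]
    exact LinearMap.congr_fun hzero v
  · intro hle i
    have hmem : Pi.single i 1 ᵥ* Γ.laplacian ∈ Γ.laplacianImage := ⟨Pi.single i 1, rfl⟩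
    rw [← hrow]
    exact hle (x := ⟨_, Γ.laplacianImage_le_sumZero hmem⟩) hmem

/-- The homomorphisms from the total sandpile group, together with a value to be taken at the vertex
`j₀`, correspond to the harmonic vectors. -/
def homProdEquivIsHarmonic (Γ : MultiDigraph V) (j₀ : V) :
    (Γ.TotalSandpile →+ G) × G ≃ {f : V → G // Γ.IsHarmonic f} where
  toFun q := ⟨fun j => (q.1.toIntLinearMap ∘ₗ Submodule.mkQ _) (singleSub j j₀) + q.2, by
    rw [isHarmonic_iff_le_ker_pairing, pairing_map_singleSub_add]
    exact (Submodule.ker_mkQ _).ge.trans (LinearMap.ker_le_ker_comp _ _)⟩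
  invFun f := ((Submodule.liftQ _ (pairing f.1)
    ((Γ.isHarmonic_iff_le_ker_pairing f.1).1 f.2)).toAddMonoidHom, f.1 j₀)
  left_inv q := by
    refine Prod.ext (AddMonoidHom.ext fun s => ?_) (by simp [singleSub_self])
    obtain ⟨x, rfl⟩ := Submodule.mkQ_surjective _ s
    exact LinearMap.congr_fun (pairing_map_singleSub_add _ j₀ q.2) x
  right_inv f := Subtype.ext <| funext fun j => by
    simp [pairing_singleSub]

theorem isSpread_homProdEquivIsHarmonic_iff [Finite G] (Γ : MultiDigraph V) (j₀ : V)
    (q : (Γ.TotalSandpile →+ G) × G) :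
    IsSpread (Γ.homProdEquivIsHarmonic j₀ q).1 ↔ Function.Surjective q.1 := by
  rw [← pairing_surjective_iff, homProdEquivIsHarmonic, Equiv.coe_fn_mk, pairing_map_singleSub_add,
    LinearMap.coe_comp]
  exact (Submodule.mkQ_surjective _).of_comp_iff q.1

theorem numSur_mul_card [Finite G] (Γ : MultiDigraph V) :
    numSur Γ.TotalSandpile G * Nat.card G
      = Nat.card {f : V → G // IsSpread f ∧ Γ.IsHarmonic f} := by
  rcases isEmpty_or_nonempty V with hV | ⟨⟨j₀⟩⟩
  · have hS : Subsingleton Γ.TotalSandpile := (Submodule.mkQ_surjective _).subsingleton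
    have hsur : ∀ φ : Γ.TotalSandpile →+ G, Function.Surjective φ ↔ Subsingleton G := fun φ =>
      ⟨fun hφ => hφ.subsingleton, fun _ => Function.surjective_to_subsingleton φ⟩
    have hspread : ∀ f : V → G, IsSpread f ↔ Subsingleton G := fun f =>
      pairing_surjective_iff.symm.trans
        ⟨fun hf => hf.subsingleton, fun _ => Function.surjective_to_subsingleton _⟩
    rcases subsingleton_or_nontrivial G with hG | hG
    · simp [numSur, hsur, hspread, hG, IsHarmonic]
    · simp [numSur, hsur, hspread, not_subsingleton G]
  · rw [numSur, ← Nat.card_prod]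
    exact Nat.card_congr <| calc
      {φ : Γ.TotalSandpile →+ G // Function.Surjective φ} × G
        ≃ {q : (Γ.TotalSandpile →+ G) × G // Function.Surjective q.1} :=
          Equiv.prodSubtypeFstEquivSubtypeProd.symm
      _ ≃ {f : {f : V → G // Γ.IsHarmonic f} // IsSpread f.1} :=
          (Γ.homProdEquivIsHarmonic j₀).subtypeEquiv fun q =>
            (Γ.isSpread_homProdEquivIsHarmonic_iff j₀ q).symm
      _ ≃ {f : V → G // IsSpread f ∧ Γ.IsHarmonic f} :=
          (Equiv.subtypeSubtypeEquivSubtypeInter _ _).trans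
            (Equiv.subtypeEquivRight fun _ => and_comm)

end MultiDigraph

section Expectation

open Finset

variable {V : Type*} [Fintype V] {G : Type*} [AddCommGroup G]

open Classical in
/-- The sum over the spread vectors `f` of the products `∏ i, q f i`, divided by the number of all
vectors. -/
noncomputable def spreadAverage [DecidableEq V] [Fintype G] (q : (V → G) → V → ℂ) : ℂ :=
  ((Fintype.card G : ℂ) ^ Fintype.card V)⁻¹ * ∑ f : V → G with IsSpread f, ∏ i, q f i

theorem MultiDigraph.numSur_eq_spreadAverage [DecidableEq V] [Fintype G] (Γ : MultiDigraph V) :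
    (numSur Γ.TotalSandpile G : ℂ) = (Fintype.card G : ℂ)⁻¹ *
      spreadAverage fun (f : V → G) i => ∑ ψ : AddChar G ℂ, ∏ j, ψ (Γ.deg i j • (f i - f j)) := by
  classical
  have hN : (Fintype.card G : ℂ) ≠ 0 := by simp
  have hprod : ∀ f : V → G, ∏ i, ∑ ψ : AddChar G ℂ, ∏ j, ψ (Γ.deg i j • (f i - f j))
      = (Fintype.card G : ℂ) ^ Fintype.card V * if Γ.IsHarmonic f then 1 else 0 := fun f => by
    have hf : Γ.IsHarmonic f ↔ ∀ i ∈ univ, ∑ j, Γ.deg i j • (f i - f j) = 0 := by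
      simp [MultiDigraph.IsHarmonic]
    simp_rw [sum_prod_addChar_eq_ite, prod_ite_zero, prod_const, card_univ, mul_boole, hf]
  have hcount : (numSur Γ.TotalSandpile G : ℂ) * Fintype.card G
      = #{f : V → G | IsSpread f ∧ Γ.IsHarmonic f} := by
    rw [← Nat.card_eq_fintype_card, ← Fintype.card_subtype, ← Nat.card_eq_fintype_card]
    exact_mod_cast Γ.numSur_mul_card (G := G)
  simp_rw [spreadAverage, hprod, ← mul_sum]
  rw [inv_mul_cancel_left₀ (pow_ne_zero _ hN), sum_boole, filter_filter, ← hcount]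
  field_simp

variable {Ω : Type*} [MeasurableSpace Ω] {μ : Measure Ω}

theorem prod_offDiag_eq_prod_prod [DecidableEq V] {M : Type*} [CommMonoid M] {c : V → V → M}
    (hc : ∀ i, c i i = 1) :
    ∏ e : {e : V × V // e.1 ≠ e.2}, c e.1.1 e.1.2 = ∏ i, ∏ j, c i j := by
  rw [← Fintype.prod_prod_type', ← Finset.prod_subtype (univ.filter fun e : V × V => e.1 ≠ e.2)
    (by simp) (fun e : V × V => c e.1 e.2)]
  exact prod_filter_of_ne fun e _ he heq => he (heq ▸ hc _)

theorem integral_prod_prod_eq_of_offDiag {𝓧 : Type*} [MeasurableSpace 𝓧] [IsProbabilityMeasure μ]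
    {y : V → V → Ω → 𝓧} (hy : ∀ i j, i ≠ j → Measurable (y i j))
    (hind : iIndepFun (fun e : {e : V × V // e.1 ≠ e.2} => y e.1.1 e.1.2) μ)
    {c : V → V → 𝓧 → ℂ} (hc : ∀ i j, Measurable (c i j)) (hc1 : ∀ i x, c i i x = 1) :
    ∫ ω, ∏ i, ∏ j, c i j (y i j ω) ∂μ = ∏ i, ∏ j, ∫ ω, c i j (y i j ω) ∂μ := by
  classical
  rw [← prod_offDiag_eq_prod_prod (by simp [hc1])]
  simp_rw [fun ω => (prod_offDiag_eq_prod_prod (c := fun i j => c i j (y i j ω))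
    fun i => hc1 i _).symm]
  exact hind.integral_fun_prod_comp (fun e => (hy _ _ e.2).aemeasurable)
    (f := fun e => c e.1.1 e.1.2) fun e => (hc _ _).aestronglyMeasurable

theorem integrable_prod_addChar_deg [Finite G] [IsFiniteMeasure μ] {Γ : Ω → MultiDigraph V}
    (hmeas : ∀ i j, i ≠ j → Measurable fun ω => (Γ ω).deg i j) (f : V → G)
    (Ψ : V → AddChar G ℂ) :
    Integrable (fun ω => ∏ i, ∏ j, Ψ i ((Γ ω).deg i j • (f i - f j))) μ := by
  refine .of_bound (C := 1) (Measurable.aestronglyMeasurable ?_) (by simp [AddChar.norm_apply])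
  refine Finset.measurable_prod _ fun i _ => Finset.measurable_prod _ fun j _ => ?_
  rcases eq_or_ne i j with rfl | hij
  · simp
  · exact (measurable_from_nat (f := fun k : ℕ => Ψ i (k • (f i - f j)))).comp (hmeas i j hij)

/-- The factor contributed by the vertex `i` to the probability that `f` is harmonic, multiplied by
the number of characters of `G`. -/
noncomputable def harmonicFactor [Finite G] (μ : Measure Ω) (Γ : Ω → MultiDigraph V) (f : V → G)
    (i : V) : ℂ :=
  ∑ ψ : AddChar G ℂ, ∏ j, ∫ ω, ψ ((Γ ω).deg i j • (f i - f j)) ∂μ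

theorem integrable_prod_sum_addChar_deg [Finite G] [IsFiniteMeasure μ] {Γ : Ω → MultiDigraph V}
    (hmeas : ∀ i j, i ≠ j → Measurable fun ω => (Γ ω).deg i j) (f : V → G) :
    Integrable (fun ω => ∏ i, ∑ ψ : AddChar G ℂ, ∏ j, ψ ((Γ ω).deg i j • (f i - f j))) μ := by
  classical
  simp_rw [prod_univ_sum]
  exact integrable_finsetSum _ fun Ψ _ => integrable_prod_addChar_deg hmeas f Ψ

theorem integral_prod_sum_addChar_deg [Finite G] [IsProbabilityMeasure μ] {Γ : Ω → MultiDigraph V}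
    (hmeas : ∀ i j, i ≠ j → Measurable fun ω => (Γ ω).deg i j)
    (hind : iIndepFun (fun (e : {e : V × V // e.1 ≠ e.2}) ω => (Γ ω).deg e.1.1 e.1.2) μ)
    (f : V → G) :
    ∫ ω, ∏ i, ∑ ψ : AddChar G ℂ, ∏ j, ψ ((Γ ω).deg i j • (f i - f j)) ∂μ
      = ∏ i, harmonicFactor μ Γ f i := by
  classical
  simp_rw [harmonicFactor, prod_univ_sum]
  rw [integral_finsetSum _ fun Ψ _ => integrable_prod_addChar_deg hmeas f Ψ]
  refine sum_congr rfl fun Ψ _ => ?_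
  exact integral_prod_prod_eq_of_offDiag hmeas hind
    (c := fun i j k => Ψ i (k • (f i - f j))) (fun _ _ => measurable_from_nat) (by simp)

variable [DecidableEq V]

theorem integrable_numSur [Finite G] [IsFiniteMeasure μ] {Γ : Ω → MultiDigraph V}
    (hmeas : ∀ i j, i ≠ j → Measurable fun ω => (Γ ω).deg i j) :
    Integrable (fun ω => (numSur (Γ ω).TotalSandpile G : ℝ)) μ := by
  have := Fintype.ofFinite G
  have hint : Integrable (fun ω => (numSur (Γ ω).TotalSandpile G : ℂ)) μ := by
    simp_rw [MultiDigraph.numSur_eq_spreadAverage, spreadAverage]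
    exact ((integrable_finsetSum _ fun f _ =>
      integrable_prod_sum_addChar_deg hmeas f).const_mul _).const_mul _
  simpa using hint.re

theorem integral_numSur [Fintype G] [IsProbabilityMeasure μ] {Γ : Ω → MultiDigraph V}
    (hmeas : ∀ i j, i ≠ j → Measurable fun ω => (Γ ω).deg i j)
    (hind : iIndepFun (fun (e : {e : V × V // e.1 ≠ e.2}) ω => (Γ ω).deg e.1.1 e.1.2) μ) :
    ((∫ ω, (numSur (Γ ω).TotalSandpile G : ℝ) ∂μ : ℝ) : ℂ)
      = (Fintype.card G : ℂ)⁻¹ * spreadAverage (harmonicFactor (G := G) μ Γ) := by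
  rw [← integral_complex_ofReal]
  simp_rw [Complex.ofReal_natCast, MultiDigraph.numSur_eq_spreadAverage, spreadAverage]
  rw [integral_const_mul, integral_const_mul,
    integral_finsetSum _ fun f _ => integrable_prod_sum_addChar_deg hmeas f]
  simp_rw [integral_prod_sum_addChar_deg hmeas hind]

end Expectation

section Deviation

open Finset

variable {V : Type*} [Fintype V] {G : Type*} [AddCommGroup G]

open Classical in
/-- The bound for the contribution of the nontrivial characters to the factor at the vertex `i` when
each edge from `i` to a vertex `j` with `ψ (f j) ≠ ψ (f i)` contracts by `ρ`. -/
noncomputable def charDeviation [Finite G] (ρ : ℝ) (f : V → G) (i : V) : ℝ :=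
  ∑ ψ ∈ univ.erase (0 : AddChar G ℂ), ρ ^ #{j | ψ (f j) ≠ ψ (f i)}

theorem norm_harmonicFactor_sub_one_le [Finite G] {Ω : Type*} [MeasurableSpace Ω] {μ : Measure Ω}
    [IsProbabilityMeasure μ] {Γ : Ω → MultiDigraph V} {ρ : ℝ}
    (hρ : ∀ i j, i ≠ j → ∀ (ψ : AddChar G ℂ) (g : G), ψ g ≠ 1 →
      ‖∫ ω, ψ ((Γ ω).deg i j • g) ∂μ‖ ≤ ρ) (f : V → G) (i : V) :
    ‖harmonicFactor μ Γ f i - 1‖ ≤ charDeviation ρ f i := by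
  classical
  rw [harmonicFactor, charDeviation, ← add_sum_erase _ _ (mem_univ (0 : AddChar G ℂ))]
  simp only [AddChar.zero_apply, integral_const, probReal_univ, one_smul, prod_const_one,
    add_sub_cancel_left]
  refine (norm_sum_le _ _).trans (sum_le_sum fun ψ _ => ?_)
  have hfactor : ∀ j, ‖∫ ω, ψ ((Γ ω).deg i j • (f i - f j)) ∂μ‖
      ≤ if ψ (f j) ≠ ψ (f i) then ρ else 1 := by
    intro j
    split_ifs with hj
    · refine hρ i j (fun hij => hj (by rw [hij])) ψ _ fun hone => hj ?_
      rw [ψ.map_sub_eq_div] at hone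
      exact (eq_of_div_eq_one hone).symm
    · simpa using norm_integral_le_of_norm_le_const (μ := μ) (C := 1)
        (.of_forall fun ω => (ψ.norm_apply ((Γ ω).deg i j • (f i - f j))).le)
  calc ‖∏ j, ∫ ω, ψ ((Γ ω).deg i j • (f i - f j)) ∂μ‖
      ≤ ∏ j, if ψ (f j) ≠ ψ (f i) then ρ else 1 := by
        rw [norm_prod]
        exact prod_le_prod (fun j _ => norm_nonneg _) fun j _ => hfactor j
    _ = ρ ^ #{j | ψ (f j) ≠ ψ (f i)} := by simp [prod_ite]

variable [Fintype G] {ρ D κ t : ℝ}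

theorem one_add_charDeviation_le_card (hρ : 0 ≤ ρ) (hρ1 : ρ ≤ 1) (f : V → G) (i : V) :
    1 + charDeviation ρ f i ≤ Fintype.card G := by
  classical
  calc 1 + charDeviation ρ f i ≤ 1 + ∑ ψ ∈ univ.erase (0 : AddChar G ℂ), 1 :=
        add_le_add_right (sum_le_sum fun _ _ => pow_le_one₀ hρ hρ1) 1
    _ = ∑ ψ : AddChar G ℂ, 1 := add_sum_erase _ (fun _ => (1 : ℝ)) (mem_univ _)
    _ = Fintype.card G := by simp

open Classical in
/-- The characters that are constant along `f` with at most `D` exceptions. -/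
noncomputable def nearlyConstantChars (D : ℝ) (f : V → G) : Finset (AddChar G ℂ) :=
  {ψ | ∃ v, (#{j | ψ (f j) ≠ v} : ℝ) ≤ D}

open Classical in
theorem mem_nearlyConstantChars {f : V → G} {ψ : AddChar G ℂ} :
    ψ ∈ nearlyConstantChars D f ↔ ∃ v, (#{j | ψ (f j) ≠ v} : ℝ) ≤ D := by
  simp [nearlyConstantChars]

theorem zero_mem_nearlyConstantChars (hD : 0 ≤ D) (f : V → G) : 0 ∈ nearlyConstantChars D f :=
  mem_nearlyConstantChars.2 ⟨1, by simpa using hD⟩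

open Classical in
theorem exists_card_notMem_commonFibre_le (hD : 0 ≤ D)
    (hDV : Fintype.card G * D < Fintype.card V) (f : V → G) :
    ∃ g, (#{j | f j ∉ commonFibre (nearlyConstantChars D f) g} : ℝ) ≤ Fintype.card G * D := by
  choose! v hv using fun ψ => (mem_nearlyConstantChars (D := D) (f := f) (ψ := ψ)).1
  set E : Finset V := (nearlyConstantChars D f).biUnion fun ψ => {j | ψ (f j) ≠ v ψ}
  have hE : (#E : ℝ) ≤ Fintype.card G * D :=
    calc (#E : ℝ) ≤ ∑ ψ ∈ nearlyConstantChars D f, (#{j | ψ (f j) ≠ v ψ} : ℝ) := by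
          exact_mod_cast card_biUnion_le
      _ ≤ #(nearlyConstantChars D f) • D := sum_le_card_nsmul _ _ _ hv
      _ ≤ Fintype.card G * D := by
          rw [nsmul_eq_mul, ← AddChar.card_eq (α := G)]
          gcongr
          exact card_le_univ _
  have hmem : ∀ j ∉ E, ∀ ψ ∈ nearlyConstantChars D f, ψ (f j) = v ψ := by simp [E]
  obtain ⟨j₀, hj₀⟩ : ∃ j₀, j₀ ∉ E := by
    by_contra! hall
    rw [eq_univ_of_forall hall, card_univ] at hE
    exact hE.not_gt hDV
  have hsub : ({j | f j ∉ commonFibre (nearlyConstantChars D f) (f j₀)} : Finset V) ⊆ E := by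
    intro j hj
    by_contra hjE
    exact (mem_filter.1 hj).2 <| mem_commonFibre.2 fun ψ hψ =>
      (hmem j hjE ψ hψ).trans (hmem j₀ hj₀ ψ hψ).symm
  exact ⟨f j₀, le_trans (mod_cast card_le_card hsub) hE⟩

theorem charDeviation_le (hρ : 0 < ρ) (hρ1 : ρ ≤ 1) (hD : 0 ≤ D) {f : V → G} (hf : IsSpread f)
    (i : V) :
    charDeviation ρ f i ≤ (#(nearlyConstantChars D f) - 1) * ρ + Fintype.card G * ρ ^ D := by
  classical
  set A := nearlyConstantChars D f
  have hρD : 0 ≤ ρ ^ D := Real.rpow_nonneg hρ.le D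
  have hterm : ∀ ψ ∈ univ.erase (0 : AddChar G ℂ), ρ ^ #{j | ψ (f j) ≠ ψ (f i)}
      ≤ (if ψ ∈ A then ρ else 0) + ρ ^ D := by
    intro ψ hψ
    split_ifs with hψA
    · obtain ⟨j, hj⟩ : ∃ j, ψ (f j) ≠ ψ (f i) := by
        obtain ⟨j, k, hjk⟩ := hf ψ (ne_of_mem_erase hψ)
        by_contra! hconst
        exact hjk ((hconst j).trans (hconst k).symm)
      have hne : #{j | ψ (f j) ≠ ψ (f i)} ≠ 0 := card_ne_zero.2 ⟨j, by simpa using hj⟩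
      linarith [pow_le_of_le_one hρ.le hρ1 hne]
    · have hfar : D < #{j | ψ (f j) ≠ ψ (f i)} := by
        by_contra! hle
        exact hψA (mem_nearlyConstantChars.2 ⟨_, hle⟩)
      rw [zero_add, ← Real.rpow_natCast]
      exact Real.rpow_le_rpow_of_exponent_ge hρ hρ1 hfar.le
  have hcardA : (#(A.erase 0) : ℝ) = #A - 1 := by
    rw [eq_sub_iff_add_eq]
    exact_mod_cast card_erase_add_one (zero_mem_nearlyConstantChars hD f)
  have herase : (univ.erase (0 : AddChar G ℂ)).filter (· ∈ A) = A.erase 0 := by ext; simp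
  calc charDeviation ρ f i
      ≤ ∑ ψ ∈ univ.erase (0 : AddChar G ℂ), ((if ψ ∈ A then ρ else 0) + ρ ^ D) :=
        sum_le_sum hterm
    _ = (#A - 1) * ρ + #(univ.erase (0 : AddChar G ℂ)) * ρ ^ D := by
        rw [sum_add_distrib, ← sum_filter, herase, sum_const, sum_const, nsmul_eq_mul, nsmul_eq_mul,
          hcardA]
    _ ≤ (#A - 1) * ρ + Fintype.card G * ρ ^ D := by
        rw [← AddChar.card_eq (α := G)]
        gcongr
        exact card_le_univ _

theorem one_add_charDeviation_le (hρ : 0 < ρ) (hD : 0 ≤ D) (hκ : 0 ≤ κ) (hκρ : 3 * κ ≤ 1 - ρ)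
    (hρD : Fintype.card G * ρ ^ D ≤ κ) {f : V → G} (hf : IsSpread f)
    (hA : 2 ≤ #(nearlyConstantChars D f)) (i : V) :
    1 + charDeviation ρ f i ≤ #(nearlyConstantChars D f) * (1 - κ) := by
  have hA' : (2 : ℝ) ≤ #(nearlyConstantChars D f) := by exact_mod_cast hA
  nlinarith [charDeviation_le hρ (by linarith) hD hf i]

theorem isSpread_of_nearlyConstantChars_eq [Nonempty V] (hD : 0 ≤ D) {f : V → G}
    (hA : nearlyConstantChars D f = {0}) : IsSpread f := by
  intro ψ hψ
  contrapose! hψ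
  obtain ⟨j₀⟩ := ‹Nonempty V›
  refine mem_singleton.1 (hA ▸ mem_nearlyConstantChars.2 ⟨ψ (f j₀), ?_⟩)
  simpa [fun j => hψ j j₀] using hD

theorem norm_prod_sub_one_le_of_nearlyConstantChars_eq (hρ : 0 < ρ) (hρ1 : ρ ≤ 1) (hD : 0 ≤ D)
    {f : V → G} (hf : IsSpread f) (hA : nearlyConstantChars D f = {0}) {q : V → ℂ}
    (hq : ∀ i, ‖q i - 1‖ ≤ charDeviation ρ f i) :
    ‖∏ i, q i - 1‖ ≤ Real.exp (Fintype.card V * (Fintype.card G * ρ ^ D)) - 1 := by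
  have hsum : ∑ i, ‖q i - 1‖ ≤ Fintype.card V * (Fintype.card G * ρ ^ D) := by
    refine (sum_le_card_nsmul univ _ (Fintype.card G * ρ ^ D) fun i _ => ?_).trans_eq (by simp)
    simpa [hA] using (hq i).trans (charDeviation_le hρ hρ1 hD hf i)
  have hprod := norm_prod_one_add_sub_one_le univ fun i => q i - 1
  simp only [add_sub_cancel] at hprod
  exact hprod.trans (by gcongr)

end Deviation

section FibreWeight

open Finset

theorem prod_le_rpow_mul_prod {ι : Type*} {s : Finset ι} {p : ι → Prop} [DecidablePred p]
    {q w : ι → ℝ} {t E : ℝ} (ht : 1 ≤ t) (hq : ∀ i, 0 ≤ q i) (hw : ∀ i, 0 ≤ w i)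
    (hp : ∀ i, p i → q i ≤ w i) (hnp : ∀ i, ¬p i → q i ≤ t * w i)
    (hE : (#{i ∈ s | ¬p i} : ℝ) ≤ E) : ∏ i ∈ s, q i ≤ t ^ E * ∏ i ∈ s, w i :=
  calc ∏ i ∈ s, q i ≤ ∏ i ∈ s, (if p i then 1 else t) * w i := by
        refine prod_le_prod (fun i _ => hq i) fun i _ => ?_
        split_ifs with hi
        · simpa using hp i hi
        · exact hnp i hi
    _ = t ^ (#{i ∈ s | ¬p i} : ℝ) * ∏ i ∈ s, w i := by
        rw [prod_mul_distrib, prod_ite, prod_const_one, one_mul, prod_const, Real.rpow_natCast]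
    _ ≤ t ^ E * ∏ i ∈ s, w i := by
        gcongr
        exact prod_nonneg fun i _ => hw i

variable {G : Type*} [AddCommGroup G] [Fintype G] {κ t : ℝ} {A : Finset (AddChar G ℂ)} {g : G}

open Classical in
/-- The weight of an entry `x` of a vector most of whose entries lie in `commonFibre A g`. Dividing
by `t` makes the exceptional entries cheap on average over `x`; it is compensated by a factor `t`
for each of them. -/
noncomputable def fibreWeight (κ t : ℝ) (A : Finset (AddChar G ℂ)) (g x : G) : ℝ :=
  if x ∈ commonFibre A g then #A * (1 - κ) else Fintype.card G / t

theorem fibreWeight_nonneg (hκ : κ ≤ 1) (ht : 0 ≤ t) (x : G) : 0 ≤ fibreWeight κ t A g x := by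
  unfold fibreWeight
  split_ifs
  · exact mul_nonneg (by positivity) (sub_nonneg.2 hκ)
  · positivity

theorem sum_fibreWeight_le (hκ : κ ≤ 1) (ht : 0 ≤ t) (A : Finset (AddChar G ℂ)) (g : G) :
    ∑ x, fibreWeight κ t A g x ≤ Fintype.card G * (1 - κ + Fintype.card G / t) := by
  classical
  have hfibre : (#(commonFibre A g) * #A : ℝ) ≤ Fintype.card G := by
    exact_mod_cast (mul_comm _ _).trans_le (card_mul_card_commonFibre_le A g)
  have hcompl : (#{x | x ∉ commonFibre A g} : ℝ) ≤ Fintype.card G := by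
    exact_mod_cast card_le_univ _
  calc ∑ x, fibreWeight κ t A g x
      = #(commonFibre A g) * #A * (1 - κ)
          + #{x | x ∉ commonFibre A g} * (Fintype.card G / t) := by
        simp [fibreWeight, sum_ite, mul_assoc]
    _ ≤ Fintype.card G * (1 - κ) + Fintype.card G * (Fintype.card G / t) := by
        have := sub_nonneg.2 hκ
        gcongr
    _ = Fintype.card G * (1 - κ + Fintype.card G / t) := by ring

variable {V : Type*} [Fintype V]

open Classical in
theorem prod_le_rpow_mul_prod_fibreWeight (hκ : κ ≤ 1) (ht : 1 ≤ t) {f : V → G} {E : ℝ}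
    (hE : (#{j | f j ∉ commonFibre A g} : ℝ) ≤ E) {q : V → ℝ} (hq : ∀ i, 0 ≤ q i)
    (hqA : ∀ i, q i ≤ #A * (1 - κ)) (hqG : ∀ i, q i ≤ Fintype.card G) :
    ∏ i, q i ≤ t ^ E * ∏ i, fibreWeight κ t A g (f i) := by
  refine prod_le_rpow_mul_prod ht hq (fun i => fibreWeight_nonneg hκ (by positivity) _)
    (fun i hi => ?_) (fun i hi => ?_) hE
  · simpa [fibreWeight, hi] using hqA i
  · simpa [fibreWeight, hi, mul_div_cancel₀ _ (zero_lt_one.trans_le ht).ne'] using hqG i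

/-- The total fibre weight of `f` over all sets of characters and all fibres, which dominates the
weight for the particular set and fibre attached to `f`. -/
noncomputable def fibreBound (κ t : ℝ) (f : V → G) : ℝ :=
  ∑ A : Finset (AddChar G ℂ), ∑ g, ∏ j, fibreWeight κ t A g (f j)

theorem fibreBound_nonneg (hκ : κ ≤ 1) (ht : 0 ≤ t) (f : V → G) : 0 ≤ fibreBound κ t f :=
  sum_nonneg fun _ _ => sum_nonneg fun _ _ => prod_nonneg fun _ _ => fibreWeight_nonneg hκ ht _

theorem prod_fibreWeight_le_fibreBound (hκ : κ ≤ 1) (ht : 0 ≤ t) (f : V → G) :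
    ∏ j, fibreWeight κ t A g (f j) ≤ fibreBound κ t f :=
  have hprod (B : Finset (AddChar G ℂ)) (x : G) : 0 ≤ ∏ j, fibreWeight κ t B x (f j) :=
    prod_nonneg fun _ _ => fibreWeight_nonneg hκ ht _
  (single_le_sum (f := fun x => ∏ j, fibreWeight κ t A x (f j)) (fun x _ => hprod A x)
    (mem_univ g)).trans <|
  single_le_sum (f := fun B => ∑ x, ∏ j, fibreWeight κ t B x (f j))
    (fun B _ => sum_nonneg fun x _ => hprod B x) (mem_univ A)

theorem sum_fibreBound_le [DecidableEq V] (hκ : κ ≤ 1) (ht : 0 ≤ t) :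
    ∑ f : V → G, fibreBound κ t f ≤ 2 ^ Fintype.card G * Fintype.card G *
      (Fintype.card G * (1 - κ + Fintype.card G / t)) ^ Fintype.card V :=
  calc ∑ f : V → G, fibreBound κ t f
      = ∑ A : Finset (AddChar G ℂ), ∑ g, ∑ f : V → G, ∏ j, fibreWeight κ t A g (f j) := by
        simp_rw [fibreBound]
        rw [sum_comm]
        exact sum_congr rfl fun A _ => sum_comm
    _ = ∑ A : Finset (AddChar G ℂ), ∑ g, (∑ x, fibreWeight κ t A g x) ^ Fintype.card V := by
        classical
        refine sum_congr rfl fun A _ => sum_congr rfl fun g _ => ?_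
        rw [← Fintype.piFinset_univ, ← prod_univ_sum, prod_const, card_univ]
    _ ≤ ∑ A : Finset (AddChar G ℂ), ∑ g : G,
          (Fintype.card G * (1 - κ + Fintype.card G / t)) ^ Fintype.card V :=
        sum_le_sum fun A _ => sum_le_sum fun g _ => pow_le_pow_left₀
          (sum_nonneg fun x _ => fibreWeight_nonneg hκ ht x) (sum_fibreWeight_le hκ ht A g) _
    _ = _ := by
        simp [AddChar.card_eq, mul_assoc]

end FibreWeight

section SpreadAverage

open Finset

variable {V : Type*} [Fintype V] {G : Type*} [AddCommGroup G] [Fintype G] {ρ D κ t : ℝ}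

theorem norm_ite_prod_sub_one_le_of_two_le_card (hρ : 0 < ρ) (hD : 0 ≤ D)
    (hDV : Fintype.card G * D < Fintype.card V) (hκ : 0 ≤ κ) (hκρ : 3 * κ ≤ 1 - ρ)
    (hρD : Fintype.card G * ρ ^ D ≤ κ) (ht : 1 ≤ t) {f : V → G}
    (hA : 2 ≤ #(nearlyConstantChars D f)) {q : V → ℂ}
    (hq : ∀ i, ‖q i - 1‖ ≤ charDeviation ρ f i) [Decidable (IsSpread f)] :
    ‖(if IsSpread f then ∏ i, q i else 0) - 1‖
      ≤ 2 * (t ^ (Fintype.card G * D) * fibreBound κ t f) := by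
  have hκ1 : κ ≤ 1 := by linarith
  obtain ⟨g, hg⟩ := exists_card_notMem_commonFibre_le hD hDV f
  have hbound : ∀ x : V → ℝ, (∀ i, 0 ≤ x i) →
      (∀ i, x i ≤ #(nearlyConstantChars D f) * (1 - κ)) → (∀ i, x i ≤ Fintype.card G) →
      ∏ i, x i ≤ t ^ (Fintype.card G * D) * fibreBound κ t f := fun x hx0 hxA hxG =>
    (prod_le_rpow_mul_prod_fibreWeight hκ1 ht hg hx0 hxA hxG).trans <|
      mul_le_mul_of_nonneg_left (prod_fibreWeight_le_fibreBound hκ1 (by positivity) f)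
        (by positivity)
  have hone : 1 ≤ t ^ (Fintype.card G * D) * fibreBound κ t f := by
    have hA' : (2 : ℝ) ≤ #(nearlyConstantChars D f) := by exact_mod_cast hA
    simpa using hbound (fun _ => 1) (fun _ => zero_le_one) (fun _ => by nlinarith)
      fun _ => by exact_mod_cast Fintype.card_pos
  suffices hprod : ‖if IsSpread f then ∏ i, q i else 0‖
      ≤ t ^ (Fintype.card G * D) * fibreBound κ t f by
    linarith [norm_sub_le (if IsSpread f then ∏ i, q i else 0) 1, norm_one (α := ℂ)]
  split_ifs with hf
  · have hnorm : ∀ i, ‖q i‖ ≤ 1 + charDeviation ρ f i := fun i => by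
      linarith [norm_le_norm_add_norm_sub' (q i) 1, hq i, norm_one (α := ℂ)]
    rw [norm_prod]
    exact hbound _ (fun i => norm_nonneg _)
      (fun i => (hnorm i).trans (one_add_charDeviation_le hρ hD hκ hκρ hρD hf hA i))
      fun i => (hnorm i).trans (one_add_charDeviation_le_card hρ.le (by linarith) f i)
  · simpa using zero_le_one.trans hone

theorem norm_ite_prod_sub_one_le (hρ : 0 < ρ) (hD : 0 ≤ D)
    (hDV : Fintype.card G * D < Fintype.card V) (hκ : 0 ≤ κ) (hκρ : 3 * κ ≤ 1 - ρ)
    (hρD : Fintype.card G * ρ ^ D ≤ κ) (ht : 1 ≤ t) (f : V → G) {q : V → ℂ}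
    (hq : ∀ i, ‖q i - 1‖ ≤ charDeviation ρ f i) [Decidable (IsSpread f)] :
    ‖(if IsSpread f then ∏ i, q i else 0) - 1‖
      ≤ (Real.exp (Fintype.card V * (Fintype.card G * ρ ^ D)) - 1)
        + 2 * (t ^ (Fintype.card G * D) * fibreBound κ t f) := by
  have hzero := zero_mem_nearlyConstantChars hD f
  have hexp : 0 ≤ Real.exp (Fintype.card V * (Fintype.card G * ρ ^ D)) - 1 :=
    sub_nonneg.2 (Real.one_le_exp (by positivity))
  rcases Nat.eq_or_lt_of_le (card_pos.2 ⟨0, hzero⟩) with hA | hA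
  · have hA : nearlyConstantChars D f = {0} := by
      obtain ⟨ψ, hψ⟩ := card_eq_one.1 hA.symm
      rw [hψ, mem_singleton] at hzero
      rw [hψ, hzero]
    have : Nonempty V := Fintype.card_pos_iff.1 <| by
      exact_mod_cast (mul_nonneg (Nat.cast_nonneg _) hD).trans_lt hDV
    have hf := isSpread_of_nearlyConstantChars_eq hD hA
    rw [if_pos hf]
    have hB := fibreBound_nonneg (t := t) (by linarith : κ ≤ 1) (by linarith) f
    exact (norm_prod_sub_one_le_of_nearlyConstantChars_eq hρ (by linarith) hD hf hA hq).trans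
      (le_add_of_nonneg_right (by positivity))
  · exact (norm_ite_prod_sub_one_le_of_two_le_card hρ hD hDV hκ hκρ hρD ht hA hq).trans
      (le_add_of_nonneg_left hexp)

variable [DecidableEq V]

open Classical in
theorem norm_spreadAverage_sub_one_le_sum (q : (V → G) → V → ℂ) :
    ‖spreadAverage q - 1‖ ≤ ((Fintype.card G : ℝ) ^ Fintype.card V)⁻¹ *
      ∑ f : V → G, ‖(if IsSpread f then ∏ i, q f i else 0) - 1‖ := by
  have hsub : spreadAverage q - 1 = ((Fintype.card G : ℂ) ^ Fintype.card V)⁻¹ *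
      ∑ f : V → G, ((if IsSpread f then ∏ i, q f i else 0) - 1) := by
    rw [spreadAverage, sum_sub_distrib, ← sum_filter, mul_sub]
    simp
  rw [hsub, norm_mul, norm_inv, norm_pow, Complex.norm_natCast]
  gcongr
  exact norm_sum_le _ _

theorem norm_spreadAverage_sub_one_le (hρ : 0 < ρ) (hD : 0 ≤ D)
    (hDV : Fintype.card G * D < Fintype.card V) (hκ : 0 ≤ κ) (hκρ : 3 * κ ≤ 1 - ρ)
    (hρD : Fintype.card G * ρ ^ D ≤ κ) (ht : 1 ≤ t) {q : (V → G) → V → ℂ}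
    (hq : ∀ f i, ‖q f i - 1‖ ≤ charDeviation ρ f i) :
    ‖spreadAverage q - 1‖
      ≤ (Real.exp (Fintype.card V * (Fintype.card G * ρ ^ D)) - 1)
        + 2 ^ (Fintype.card G + 1) * Fintype.card G *
          (t ^ (Fintype.card G * D) * (1 - κ + Fintype.card G / t) ^ Fintype.card V) := by
  classical
  refine (norm_spreadAverage_sub_one_le_sum q).trans ?_
  rw [inv_mul_le_iff₀ (by positivity)]
  refine (sum_le_sum fun f _ =>
    norm_ite_prod_sub_one_le hρ hD hDV hκ hκρ hρD ht f (hq f)).trans ?_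
  rw [sum_add_distrib, ← mul_sum, ← mul_sum, sum_const, card_univ, Fintype.card_fun, nsmul_eq_mul,
    Nat.cast_pow, mul_add]
  refine add_le_add_right ?_ _
  calc 2 * (t ^ (Fintype.card G * D) * ∑ f : V → G, fibreBound κ t f)
      ≤ 2 * (t ^ (Fintype.card G * D) * (2 ^ Fintype.card G * Fintype.card G *
          (Fintype.card G * (1 - κ + Fintype.card G / t)) ^ Fintype.card V)) := by
        gcongr
        exact sum_fibreBound_le (by linarith) (by linarith)
    _ = _ := by rw [mul_pow]; ring

theorem norm_spreadAverage_sub_one_le_card_pow (hρ : 0 ≤ ρ) (hρ1 : ρ ≤ 1) {q : (V → G) → V → ℂ}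
    (hq : ∀ f i, ‖q f i - 1‖ ≤ charDeviation ρ f i) :
    ‖spreadAverage q - 1‖ ≤ (Fintype.card G : ℝ) ^ Fintype.card V + 1 := by
  classical
  refine (norm_spreadAverage_sub_one_le_sum q).trans ?_
  rw [inv_mul_le_iff₀ (by positivity)]
  refine (sum_le_card_nsmul univ _ ((Fintype.card G : ℝ) ^ Fintype.card V + 1)
    fun f _ => ?_).trans_eq (by simp [mul_add])
  have hprod : ‖∏ i, q f i‖ ≤ (Fintype.card G : ℝ) ^ Fintype.card V := by
    rw [norm_prod]
    refine (prod_le_prod (fun i _ => norm_nonneg _) fun i _ => ?_).trans_eq (prod_const _)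
    linarith [norm_le_norm_add_norm_sub' (q f i) 1, hq f i, norm_one (α := ℂ),
      one_add_charDeviation_le_card hρ hρ1 f i]
  refine (norm_sub_le _ _).trans ?_
  split_ifs
  · simpa using hprod
  · simp

end SpreadAverage

section Asymptotics

open Filter Asymptotics

theorem isBigO_exp_mul_pow_sub_one (C : ℝ) {r m : ℝ} (hr : 0 ≤ r) (hrm : r < m) (hm : m < 1) :
    (fun n : ℕ => Real.exp (n * (C * r ^ n)) - 1) =O[atTop] fun n => m ^ n := by
  have hx : (fun n : ℕ => (n : ℝ) * (C * r ^ n)) =o[atTop] fun n => m ^ n := by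
    have hlittle := (isLittleO_pow_const_mul_const_pow_const_pow_of_norm_lt (R := ℝ) 1
      (by rwa [Real.norm_of_nonneg hr] : ‖r‖ < m)).const_mul_left C
    exact hlittle.congr_left fun n => by ring
  have hlim : Tendsto (fun n : ℕ => (n : ℝ) * (C * r ^ n)) atTop (𝓝 0) :=
    hx.trans_tendsto (tendsto_pow_atTop_nhds_zero_of_lt_one (hr.trans hrm.le) hm)
  have hexp : (fun x : ℝ => Real.exp x - 1) =O[𝓝 0] fun x => x := by
    simpa using (Real.hasDerivAt_exp 0).isBigO_sub
  exact (hexp.comp_tendsto hlim).trans hx.isBigO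

theorem exists_forall_le_mul_exp {e : ℕ → ℝ} {m : ℝ} (hm : 0 < m) (hm1 : m < 1)
    (he : e =O[atTop] fun n => m ^ n) :
    ∃ K c : ℝ, 0 < K ∧ 0 < c ∧ ∀ n : ℕ, e n ≤ K * Real.exp (-c * n) := by
  obtain ⟨K, hK, hbound⟩ := bound_of_isBigO_nat_atTop he
  refine ⟨K, -Real.log m, hK, neg_pos.2 (Real.log_neg hm hm1), fun n => ?_⟩
  have hpow : Real.exp (-(-Real.log m) * n) = m ^ n := by
    rw [neg_neg, mul_comm, Real.exp_nat_mul, Real.exp_log hm]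
  rw [hpow]
  calc e n ≤ ‖e n‖ := Real.le_norm_self _
    _ ≤ K * ‖m ^ n‖ := hbound (pow_ne_zero n hm.ne')
    _ = K * m ^ n := by rw [Real.norm_of_nonneg (by positivity)]

theorem exists_rpow_mul_lt_one {t b : ℝ} (ht : 0 < t) (hb : b < 1) :
    ∃ η : ℝ, 0 < η ∧ η < 1 ∧ t ^ η * b < 1 := by
  have hcont : Continuous fun η : ℝ => t ^ η * b :=
    (Real.continuous_const_rpow ht.ne').mul continuous_const
  have hlt : ∀ᶠ η : ℝ in 𝓝[>] 0, t ^ η * b < 1 :=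
    (hcont.tendsto' 0 b (by simp)).mono_left nhdsWithin_le_nhds |>.eventually_lt_const hb
  obtain ⟨η, hη, hη0, hη1⟩ := (hlt.and (Ioo_mem_nhdsGT one_pos)).exists
  exact ⟨η, hη0, hη1, hη⟩

theorem norm_spreadAverage_sub_one_le_exp_add_pow {V : Type*} [Fintype V] [DecidableEq V]
    [Nonempty V] {G : Type*} [AddCommGroup G] [Fintype G] {ρ κ t η : ℝ} (hρ : 0 < ρ) (hη : 0 ≤ η)
    (hη1 : η < 1) (hκ : 0 ≤ κ) (hκρ : 3 * κ ≤ 1 - ρ) (ht : 1 ≤ t)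
    (hsmall : Fintype.card G * (ρ ^ (η / Fintype.card G)) ^ Fintype.card V ≤ κ)
    {q : (V → G) → V → ℂ} (hq : ∀ f i, ‖q f i - 1‖ ≤ charDeviation ρ f i) :
    ‖spreadAverage q - 1‖
      ≤ (Real.exp (Fintype.card V *
          (Fintype.card G * (ρ ^ (η / Fintype.card G)) ^ Fintype.card V)) - 1)
        + 2 ^ (Fintype.card G + 1) * Fintype.card G *
          (t ^ η * (1 - κ + Fintype.card G / t)) ^ Fintype.card V := by
  have hD : Fintype.card G * (η / Fintype.card G * Fintype.card V) = η * Fintype.card V := by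
    field_simp
  rw [mul_pow, ← Real.rpow_mul_natCast hρ.le, ← Real.rpow_mul_natCast (by linarith), ← hD]
  rw [← Real.rpow_mul_natCast hρ.le] at hsmall
  refine norm_spreadAverage_sub_one_le hρ (by positivity) ?_ hκ hκρ hsmall ht hq
  rw [hD]
  exact mul_lt_of_lt_one_left (by exact_mod_cast Fintype.card_pos) hη1

theorem exists_isBigO_norm_spreadAverage_sub_one_le (G : Type*) [AddCommGroup G] [Fintype G]
    {ρ : ℝ} (hρ : 0 < ρ) (hρ1 : ρ < 1) :
    ∃ (e : ℕ → ℝ) (m : ℝ), 0 < m ∧ m < 1 ∧ e =O[atTop] (fun n => m ^ n) ∧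
      ∀ᶠ n in atTop, ∀ (V : Type*) [Fintype V] [DecidableEq V] (q : (V → G) → V → ℂ),
        Fintype.card V = n → (∀ f i, ‖q f i - 1‖ ≤ charDeviation ρ f i) →
        ‖spreadAverage q - 1‖ ≤ e n := by
  set N : ℝ := (Fintype.card G : ℝ)
  have hN : 1 ≤ N := Nat.one_le_cast.2 Fintype.card_pos
  obtain ⟨κ, hκ, hκρ⟩ : ∃ κ : ℝ, 0 < κ ∧ 3 * κ = 1 - ρ := ⟨(1 - ρ) / 3, by linarith, by ring⟩
  obtain ⟨t, ht, hNt⟩ : ∃ t : ℝ, 1 ≤ t ∧ 1 - κ + N / t = 1 - κ / 2 :=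
    ⟨2 * N / κ, (one_le_div hκ).2 (by linarith), by field_simp; ring⟩
  obtain ⟨η, hη0, hη1, hs1⟩ := exists_rpow_mul_lt_one (b := 1 - κ / 2)
    (zero_lt_one.trans_le ht) (by linarith)
  rw [← hNt] at hs1
  set r : ℝ := ρ ^ (η / N)
  have hr0 : 0 < r := Real.rpow_pos_of_pos hρ _
  have hr1 : r < 1 := Real.rpow_lt_one hρ.le hρ1 (by positivity)
  set s : ℝ := t ^ η * (1 - κ + N / t)
  have hs0 : 0 ≤ s := mul_nonneg (by positivity) (by rw [hNt]; linarith)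
  obtain ⟨m, hm, hm1⟩ := exists_between (max_lt hr1 hs1)
  obtain ⟨hrm, hsm⟩ := max_lt_iff.1 hm
  refine ⟨fun n => (Real.exp (n * (N * r ^ n)) - 1) + 2 ^ (Fintype.card G + 1) * N * s ^ n, m,
    hr0.trans hrm, hm1, ?_, ?_⟩
  · exact (isBigO_exp_mul_pow_sub_one N hr0.le hrm hm1).add
      ((isLittleO_pow_pow_of_lt_left hs0 hsm).isBigO.const_mul_left _)
  have hsmall : ∀ᶠ n : ℕ in atTop, N * r ^ n < κ := by
    have hlim := (tendsto_pow_atTop_nhds_zero_of_lt_one hr0.le hr1).const_mul N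
    rw [mul_zero] at hlim
    exact hlim.eventually_lt_const hκ
  filter_upwards [hsmall, eventually_gt_atTop 0] with n hn hn0 V _ _ q hV hq
  subst hV
  have : Nonempty V := Fintype.card_pos_iff.1 hn0
  exact norm_spreadAverage_sub_one_le_exp_add_pow hρ hη0.le hη1 hκ.le hκρ.le ht hn.le hq

theorem exists_norm_spreadAverage_sub_one_le (G : Type*) [AddCommGroup G] [Fintype G] {ρ : ℝ}
    (hρ : 0 < ρ) (hρ1 : ρ < 1) :
    ∃ K c : ℝ, 0 < K ∧ 0 < c ∧
      ∀ (V : Type*) [Fintype V] [DecidableEq V] (q : (V → G) → V → ℂ),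
        (∀ f i, ‖q f i - 1‖ ≤ charDeviation ρ f i) →
        ‖spreadAverage q - 1‖ ≤ K * Real.exp (-c * Fintype.card V) := by
  obtain ⟨e, m, hm, hm1, he, hlarge⟩ := exists_isBigO_norm_spreadAverage_sub_one_le G hρ hρ1
  obtain ⟨n₀, hn₀⟩ := eventually_atTop.1 hlarge
  set e' : ℕ → ℝ := fun n => if n₀ ≤ n then e n else (Fintype.card G : ℝ) ^ n + 1
  have he' : e' =O[atTop] fun n => m ^ n := he.congr' (by
    filter_upwards [eventually_ge_atTop n₀] with n hn using (if_pos hn).symm) .rfl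
  obtain ⟨K, c, hK, hc, hKc⟩ := exists_forall_le_mul_exp hm hm1 he'
  refine ⟨K, c, hK, hc, fun V _ _ q hq => le_trans ?_ (hKc (Fintype.card V))⟩
  simp only [e']
  split_ifs with hV
  · exact hn₀ _ hV V q rfl hq
  · exact norm_spreadAverage_sub_one_le_card_pow hρ.le hρ1.le hq

end Asymptotics

theorem theorem3p1_general (G : Type*) [AddCommGroup G] [Finite G] {ε : ℝ} (hε : 0 < ε) :
    ∃ K c : ℝ, 0 < K ∧ 0 < c ∧
      ∀ (V : Type*) [Fintype V] [DecidableEq V] (Ω : Type*) [MeasurableSpace Ω] (μ : Measure Ω)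
        [IsProbabilityMeasure μ] (Γ : Ω → MultiDigraph V),
        IsBalancedDigraphMod (AddMonoid.exponent G) ε Γ μ →
        Integrable (fun ω => (numSur (Γ ω).TotalSandpile G : ℝ)) μ ∧
        |(∫ ω, (numSur (Γ ω).TotalSandpile G : ℝ) ∂μ) - 1 / (Nat.card G : ℝ)|
          ≤ K * Real.exp (-c * Fintype.card V) := by
  have := Fintype.ofFinite G
  obtain ⟨ρ, hρ, hρ1, hcontract⟩ := exists_norm_integral_addChar_nsmul_le G hε
  obtain ⟨K, c, hK, hc, hKc⟩ := exists_norm_spreadAverage_sub_one_le G hρ hρ1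
  refine ⟨K, c, hK, hc, fun V _ _ Ω _ μ _ Γ hΓ => ⟨integrable_numSur hΓ.measurable, ?_⟩⟩
  have hdev : ∀ f i, ‖harmonicFactor (G := G) μ Γ f i - 1‖ ≤ charDeviation ρ f i :=
    norm_harmonicFactor_sub_one_le fun i j hij =>
      hcontract Ω μ _ (hΓ.measurable i j hij) (hΓ.balanced i j hij)
  have hexpect := integral_numSur (G := G) hΓ.measurable hΓ.indep
  have hcard : (Fintype.card G : ℝ)⁻¹ ≤ 1 := Nat.cast_inv_le_one _
  calc |(∫ ω, (numSur (Γ ω).TotalSandpile G : ℝ) ∂μ) - 1 / (Nat.card G : ℝ)|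
      = ‖(Fintype.card G : ℂ)⁻¹ * (spreadAverage (harmonicFactor (G := G) μ Γ) - 1)‖ := by
        rw [← Real.norm_eq_abs, ← Complex.norm_real, mul_sub, ← hexpect]
        simp
    _ = (Fintype.card G : ℝ)⁻¹ * ‖spreadAverage (harmonicFactor (G := G) μ Γ) - 1‖ := by simp
    _ ≤ ‖spreadAverage (harmonicFactor (G := G) μ Γ) - 1‖ :=
        mul_le_of_le_one_left (norm_nonneg _) hcard
    _ ≤ K * Real.exp (-c * Fintype.card V) := hKc V _ hdev

theorem theorem3p1 (a : ℕ) (ha : 0 < a) (ε : ℝ) (hε : 0 < ε)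
    (G : Type*) [AddCommGroup G] [Finite G] (hG : AddMonoid.exponent G ∣ a) :
    ∃ K c : ℝ, 0 < K ∧ 0 < c ∧
      ∀ (n : ℕ) (Ω : Type*) [MeasurableSpace Ω] (μ : Measure Ω) [IsProbabilityMeasure μ]
        (Γ : Ω → MultiDigraph (Fin n)), IsBalancedDigraph ε Γ μ →
        Integrable (fun ω => (numSur (Γ ω).TotalSandpile G : ℝ)) μ ∧
        |(∫ ω, (numSur (Γ ω).TotalSandpile G : ℝ) ∂μ) - 1 / (Nat.card G : ℝ)|
          ≤ K * Real.exp (-c * n) := by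
  obtain ⟨K, c, hK, hc, h⟩ := theorem3p1_general G hε
  exact ⟨K, c, hK, hc, fun n Ω _ μ _ Γ hΓ => by
    simpa using h (Fin n) Ω μ Γ (hΓ.isBalancedDigraphMod _)⟩
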